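/- Let $k$ be a field of characteristic zero and let $A = k\langle x,y\rangle/(x^2,\; y^2x - xy^2 - xyx)$ be the super Jordan plane, graded by $\deg x=\deg y=1$ and augmented by $\varepsilon\colon A\to k$, $x,y\mapsto 0$. Regard $k$ as an $A$-module through $\varepsilon$, and let $E(A)=\bigoplus_{n\ge 0}\operatorname{Ext}^n_A(k,k)$ be the Yoneda algebra of $A$, with the Yoneda product. Then $A$ is a $\mathcal K_2$-algebra in the sense of Cassidy and Shelton: $E(A)$ is generated, as a $k$-algebra, by $\operatorname{Ext}^1_A(k,k)$ and $\operatorname{Ext}^2_A(k,k)$. Moreover, $A$ is not $N$-Koszul for any $N\ge 2$: there is no graded projective resolution $\cdots\to P_1\to P_0\to k\to 0$ of the trivial $A$-module in which, for every $m \ge 0$, $P_{2m}$ is generated in degree $mN$ and $P_{2m+1}$ is generated in degree $mN+1$. -/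

import Mathlib

open CategoryTheory CategoryTheory.Abelian
open scoped DirectSum

universe w t v u

section SelfExt

/-! ### The Yoneda product on `⨁ n, Ext^n(X, X)` -/

variable {C : Type u} [Category.{v} C] [Abelian C] [HasExt.{w} C]

/-- The group `Ext^n(X, X)`. -/
abbrev SelfExt (X : C) (n : ℕ) : Type w := Ext.{w} X X n

/-- The unit is the identity of `X`, regarded as an element of `Ext^0(X, X)`. -/
noncomputable instance SelfExt.instGOne (X : C) : GradedMonoid.GOne (SelfExt X) where
  one := Ext.mk₀ (𝟙 X)

/-- The Yoneda product: `α * β` is the composite `β` followed by `α`. -/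
noncomputable instance SelfExt.instGMul (X : C) : GradedMonoid.GMul (SelfExt X) where
  mul {i j} α β := Ext.comp β α (add_comm j i)

theorem SelfExt.mk_eq (X : C) {m n : ℕ} (h : m = n) (α : SelfExt X m) (β : SelfExt X n)
    (hαβ : Ext.comp α (Ext.mk₀ (𝟙 X)) (by omega : m + 0 = n) = β) :
    (GradedMonoid.mk m α : GradedMonoid (SelfExt X)) = GradedMonoid.mk n β := by
  subst h
  rw [Ext.comp_mk₀_id] at hαβ
  rw [hαβ]

noncomputable instance SelfExt.instGMonoid (X : C) : GradedMonoid.GMonoid (SelfExt X) where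
  one_mul a := by
    obtain ⟨n, a⟩ := a
    refine SelfExt.mk_eq X (zero_add n) _ _ ?_
    change Ext.comp (Ext.comp a (Ext.mk₀ (𝟙 X)) (add_comm n 0)) _ _ = a
    rw [Ext.comp_assoc _ _ _ _ (zero_add 0) (by omega), Ext.mk₀_comp_mk₀, Category.comp_id,
      Ext.comp_mk₀_id]
  mul_one a := by
    obtain ⟨n, a⟩ := a
    refine SelfExt.mk_eq X (add_zero n) _ _ ?_
    change Ext.comp (Ext.comp (Ext.mk₀ (𝟙 X)) a (add_comm 0 n)) _ _ = a
    rw [Ext.comp_assoc _ _ _ _ (add_zero n) (by omega), Ext.comp_mk₀_id, Ext.mk₀_id_comp]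
  mul_assoc a b c := by
    obtain ⟨l, a⟩ := a
    obtain ⟨m, b⟩ := b
    obtain ⟨n, c⟩ := c
    refine SelfExt.mk_eq X (add_assoc l m n) _ _ ?_
    change Ext.comp (Ext.comp c (Ext.comp b a (add_comm m l)) (add_comm n (l + m))) _ _ =
      Ext.comp (Ext.comp c b (add_comm n m)) a (add_comm (m + n) l)
    rw [Ext.comp_assoc (a₁₂ := l + m + n) (a₂₃ := l + m) _ _ _ _ (by omega) (by omega),
      Ext.comp_mk₀_id]
    exact (Ext.comp_assoc _ _ _ _ _ (by omega)).symm

noncomputable instance SelfExt.instGRing (X : C) : DirectSum.GRing (SelfExt X) where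
  mul_zero _ := Ext.zero_comp _ _ _ _ _
  zero_mul _ := Ext.comp_zero _ _ _ _ _
  mul_add _ _ _ := Ext.add_comp _ _ _ _
  add_mul _ _ _ := Ext.comp_add _ _ _ _
  natCast n := n • Ext.mk₀ (𝟙 X)
  natCast_zero := zero_smul _ _
  natCast_succ n := succ_nsmul _ n
  intCast n := n • Ext.mk₀ (𝟙 X)
  intCast_ofNat n := natCast_zsmul _ n
  intCast_negSucc_ofNat n := negSucc_zsmul _ n

variable {k : Type t} [CommRing k] [Linear k C]

/-- In a `k`-linear category, `⨁ n, Ext^n(X, X)` is a `k`-algebra through `c ↦ c • 1`. -/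
noncomputable instance SelfExt.instGAlgebra (X : C) : DirectSum.GAlgebra k (SelfExt X) where
  toFun :=
    { toFun := fun c => c • Ext.mk₀ (𝟙 X)
      map_zero' := zero_smul _ _
      map_add' := fun c d => add_smul c d _ }
  map_one := one_smul _ _
  map_mul c d := by
    refine SelfExt.mk_eq X (zero_add 0).symm _ _ ?_
    change Ext.comp ((c * d) • Ext.mk₀ (𝟙 X)) (Ext.mk₀ (𝟙 X)) _ =
      Ext.comp (d • Ext.mk₀ (𝟙 X)) (c • Ext.mk₀ (𝟙 X)) _
    rw [Ext.smul_comp, Ext.smul_comp, Ext.comp_smul, smul_smul, mul_comm]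
  commutes c x := by
    obtain ⟨n, x⟩ := x
    refine SelfExt.mk_eq X (add_comm 0 n) _ _ ?_
    change Ext.comp (Ext.comp x (c • Ext.mk₀ (𝟙 X)) (add_comm n 0)) (Ext.mk₀ (𝟙 X)) _ =
      Ext.comp (c • Ext.mk₀ (𝟙 X)) x (add_comm 0 n)
    rw [Ext.comp_assoc _ _ _ _ (zero_add 0) (by omega), Ext.comp_mk₀_id, Ext.comp_smul,
      Ext.smul_comp, Ext.comp_mk₀_id, Ext.mk₀_id_comp]
  smul_def c x := by
    obtain ⟨n, x⟩ := x
    refine SelfExt.mk_eq X (zero_add n).symm _ _ ?_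
    change Ext.comp (c • x) (Ext.mk₀ (𝟙 X)) _ = Ext.comp x (c • Ext.mk₀ (𝟙 X)) (add_comm n 0)
    rw [Ext.smul_comp, Ext.comp_smul]

end SelfExt

section YonedaAlgebra

/-! ### The Yoneda algebra of an augmented algebra -/

variable {k : Type u} [Field k] {A : Type u} [Ring A] [Algebra k A]

/-- The trivial left `A`-module `k`, on which `a : A` acts as multiplication by `ε a`. -/
noncomputable def trivialModule (ε : A →ₐ[k] k) : ModuleCat.{u} A :=
  (ModuleCat.restrictScalars ε.toRingHom).obj (ModuleCat.of k k)

/-- The Yoneda algebra `E(A) = ⨁ n, Ext_A^n(k, k)` of a `k`-algebra `A` with augmentation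
`ε : A → k`, with the Yoneda product. -/
abbrev YonedaAlgebra (ε : A →ₐ[k] k) : Type u := ⨁ n : ℕ, SelfExt.{u} (trivialModule ε) n

/-- `A` is a `𝒦₂`-algebra: its Yoneda algebra is generated, as a `k`-algebra, by
`E^1(A) = Ext_A^1(k, k)` and `E^2(A) = Ext_A^2(k, k)`. -/
def IsK2 (ε : A →ₐ[k] k) : Prop :=
  Algebra.adjoin k
    (Set.range (DirectSum.of (SelfExt.{u} (trivialModule ε)) 1) ∪
      Set.range (DirectSum.of (SelfExt.{u} (trivialModule ε)) 2)) =
    (⊤ : Subalgebra k (YonedaAlgebra ε))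

end YonedaAlgebra

section NKoszul

/-! ### `N`-Koszul algebras -/

variable {k : Type u} [Field k] {A : Type u} [Ring A] [Algebra k A]

/-- The jump function `δ`: `δ (2 m) = m N` and `δ (2 m + 1) = m N + 1`. -/
def koszulJump (N n : ℕ) : ℕ := (n / 2) * N + n % 2

/-- A connected graded algebra `A = ⨁ n, 𝒜 n` with augmentation `ε` is `N`-Koszul (`N ≥ 2`) if the
trivial module `k` has a graded projective resolution `⋯ → P 1 → P 0 → k → 0` in which `P n` is
generated in the single degree `koszulJump N n`. Graded projective modules that are generated in
one degree over a connected graded algebra are graded free, so `P n` is the free module on a set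
`ι n` of generators of degree `koszulJump N n`; the differential `d n : P (n + 1) → P n` is
homogeneous of degree `0`, that is, its matrix entries lie in `𝒜 a` for
`a + koszulJump N n = koszulJump N (n + 1)`. -/
def IsNKoszul (𝒜 : ℕ → Submodule k A) [GradedAlgebra 𝒜] (ε : A →ₐ[k] k) (N : ℕ) : Prop :=
  ∃ (ι : ℕ → Type u) (d : ∀ n, (ι (n + 1) →₀ A) →ₗ[A] (ι n →₀ A))
    (p : (ι 0 →₀ A) →ₗ[A] trivialModule ε),
    Function.Surjective p ∧ Function.Exact (d 0) p ∧
    (∀ n, Function.Exact (d (n + 1)) (d n)) ∧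
    ∀ n (i : ι (n + 1)) (j : ι n),
      ∃ a, a + koszulJump N n = koszulJump N (n + 1) ∧ d n (Finsupp.single i 1) j ∈ 𝒜 a

end NKoszul

section SuperJordanPlane

/-! ### The super Jordan plane -/

variable (k : Type u) [Field k]

/-- The defining relations `x² = 0` and `y²x = xy² + xyx`, where `x` and `y` are the generators
with index `0` and `1`. -/
inductive SuperJordanPlane.Rel : FreeAlgebra k (Fin 2) → FreeAlgebra k (Fin 2) → Prop
  | quadratic : Rel (FreeAlgebra.ι k 0 * FreeAlgebra.ι k 0) 0
  | cubic : Rel (FreeAlgebra.ι k 1 * FreeAlgebra.ι k 1 * FreeAlgebra.ι k 0)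
      (FreeAlgebra.ι k 0 * FreeAlgebra.ι k 1 * FreeAlgebra.ι k 1 +
        FreeAlgebra.ι k 0 * FreeAlgebra.ι k 1 * FreeAlgebra.ι k 0)

/-- The super Jordan plane `k⟨x, y⟩ / (x², y²x - xy² - xyx)`. -/
def SuperJordanPlane : Type u := RingQuot (SuperJordanPlane.Rel k)

namespace SuperJordanPlane

noncomputable instance instRing : Ring (SuperJordanPlane k) :=
  inferInstanceAs (Ring (RingQuot (Rel k)))

noncomputable instance instAlgebra : Algebra k (SuperJordanPlane k) :=
  inferInstanceAs (Algebra k (RingQuot (Rel k)))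

/-- The quotient map from the free algebra. -/
noncomputable def mk : FreeAlgebra k (Fin 2) →ₐ[k] SuperJordanPlane k :=
  RingQuot.mkAlgHom k (Rel k)

/-- The generators: `gen k 0 = x` and `gen k 1 = y`. -/
noncomputable def gen (i : Fin 2) : SuperJordanPlane k :=
  mk k (FreeAlgebra.ι k i)

theorem gen_quadratic : gen k 0 * gen k 0 = 0 := by
  have h := RingQuot.mkAlgHom_rel k (Rel.quadratic (k := k))
  change mk k _ = mk k _ at h
  simpa only [gen, map_mul, map_zero] using h

theorem gen_cubic : gen k 1 * gen k 1 * gen k 0 =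
    gen k 0 * gen k 1 * gen k 1 + gen k 0 * gen k 1 * gen k 0 := by
  have h := RingQuot.mkAlgHom_rel k (Rel.cubic (k := k))
  change mk k _ = mk k _ at h
  simpa only [gen, map_mul, map_add] using h

variable {k} in
/-- The algebra map out of the super Jordan plane given by two elements satisfying the relations. -/
noncomputable def lift {B : Type*} [Semiring B] [Algebra k B] (f : Fin 2 → B)
    (h₁ : f 0 * f 0 = 0) (h₂ : f 1 * f 1 * f 0 = f 0 * f 1 * f 1 + f 0 * f 1 * f 0) :
    SuperJordanPlane k →ₐ[k] B :=
  RingQuot.liftAlgHom k ⟨FreeAlgebra.lift k f, by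
    intro a b hab
    cases hab with
    | quadratic => simpa using h₁
    | cubic => simpa using h₂⟩

variable {k} in
@[simp]
theorem lift_gen {B : Type*} [Semiring B] [Algebra k B] (f : Fin 2 → B)
    (h₁ : f 0 * f 0 = 0) (h₂ : f 1 * f 1 * f 0 = f 0 * f 1 * f 1 + f 0 * f 1 * f 0) (i : Fin 2) :
    lift f h₁ h₂ (gen k i) = f i := by
  exact (RingQuot.liftAlgHom_mkAlgHom_apply k _ _ _).trans (FreeAlgebra.lift_ι_apply _ _)

variable {k} in
theorem hom_ext {B : Type*} [Semiring B] [Algebra k B] {f g : SuperJordanPlane k →ₐ[k] B}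
    (h : ∀ i, f (gen k i) = g (gen k i)) : f = g := by
  apply RingQuot.ringQuot_ext'
  apply FreeAlgebra.hom_ext
  funext i
  exact h i

/-- The augmentation, sending `x` and `y` to `0`. -/
noncomputable def augmentation : SuperJordanPlane k →ₐ[k] k :=
  lift (fun _ => 0) (by simp) (by simp)

/-- The grading with `deg x = deg y = 1`: the component of degree `n` is the `n`-th power of the
span of `x` and `y`, that is, the span of the words of length `n`. -/
noncomputable def component (n : ℕ) : Submodule k (SuperJordanPlane k) :=
  Submodule.span k (Set.range (gen k)) ^ n

noncomputable instance : SetLike.GradedMonoid (component k) :=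
  Submodule.nat_power_gradedMonoid (Submodule.span k (Set.range (gen k)))

theorem gen_mem (i : Fin 2) : gen k i ∈ component k 1 := by
  rw [component, pow_one]
  exact Submodule.subset_span ⟨i, rfl⟩

/-- The generator with index `i`, in the degree one part of the direct sum of the components. -/
noncomputable def gradedGen (i : Fin 2) : ⨁ n, component k n :=
  DirectSum.of (fun n => component k n) 1 ⟨gen k i, gen_mem k i⟩

/-- The algebra map to the direct sum of the components, sending each generator to its copy in
degree one. -/
noncomputable def decomposeHom : SuperJordanPlane k →ₐ[k] ⨁ n, component k n :=
  lift (gradedGen k)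
    (by
      rw [gradedGen, DirectSum.of_mul_of, ← map_zero (DirectSum.of (fun n => component k n) (1 + 1))]
      congr 1
      exact Subtype.ext (gen_quadratic k))
    (by
      simp only [gradedGen, DirectSum.of_mul_of]
      rw [← map_add]
      congr 1
      exact Subtype.ext (gen_cubic k))

/-- The super Jordan plane is a graded algebra with `x` and `y` in degree one. -/
noncomputable instance instGradedAlgebra : GradedAlgebra (component k) :=
  GradedAlgebra.ofAlgHom (component k) (decomposeHom k)
    (by
      apply hom_ext
      intro i
      simp [decomposeHom, gradedGen])
    (by
      intro n a
      obtain ⟨a, ha⟩ := a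
      dsimp only
      unfold component at ha
      induction ha using Submodule.pow_induction_on_left' with
      | algebraMap r => simp only [AlgHom.commutes, DirectSum.algebraMap_apply]; rfl
      | add x y i hx hy ihx ihy => simp only [map_add, ihx, ihy]; rw [← map_add]; rfl
      | mem_mul m hm i x hx ih =>
        have key : decomposeHom k m = DirectSum.of (fun n => component k n) 1
            ⟨m, by rw [component, pow_one]; exact hm⟩ := by
          induction hm using Submodule.span_induction with
          | mem z hz =>
            obtain ⟨i, rfl⟩ := hz
            simp [decomposeHom, gradedGen]
          | zero => rw [map_zero]; exact (map_zero (DirectSum.of _ 1)).symm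
          | add a b ha hb iha ihb => rw [map_add, iha, ihb, ← map_add]; rfl
          | smul c a ha iha =>
            rw [map_smul, iha, ← DirectSum.lof_eq_of k, ← map_smul]; rfl
        rw [map_mul, key, ih, DirectSum.of_mul_of]
        exact DirectSum.of_eq_of_gradedMonoid_eq (Sigma.subtype_ext (add_comm _ _) rfl))

end SuperJordanPlane

end SuperJordanPlane

/-! Put z = xy + yx. The relations give zx = xz and zy = yz - xz, so A is spanned by the elements
y^i z^j and y^i z^j x. They are independent because right multiplication, written on pairs of
polynomials, satisfies the relations. Kernels of right multiplications thereby become divisibility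
questions in k[y, z], and k gets a resolution A ← A² ← A² ← A² ← ⋯ by `generatorMap`, `relationMap`
and then `periodicMap` forever.

Generation: `periodicMap` sends the basis to (x, 0) and (y² - xy, -x), so x occurs linearly in each
coordinate. Hence every functional on a syzygy in the periodic range is `xFunctional` after the
restriction of a map A² → A (`exists_extClass_comp_mk₀`). By dimension shifting, each class of
degree at least 3 is the class dual to x times a class of one degree less
(`selfExt_exists_comp_xClass`).

Failure of N-Koszulity: the second term of the resolution would be generated in one degree, but A
needs a quadratic and a cubic relation (`not_exact_of_homogeneous`). -/

namespace SuperJordanPlane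

/-! ### Normal forms and kernels of right multiplication. -/

open Polynomial

variable (k : Type u) [Field k]

/-- The underlying space of the right regular representation: the pair `(p, q)` of polynomials in
an inner variable `Y` and an outer variable `Z` stands for `p(y, z) + q(y, z) x`, where
`z = x y + y x` and powers of `y` are written to the left of powers of `z`. -/
abbrev NormalForm : Type u := k[X][X] × k[X][X]

/-- Right multiplication by `x` on normal forms. -/
noncomputable def rightX : Module.End k (NormalForm k) where
  toFun v := (0, v.1)
  map_add' _ _ := by simp
  map_smul' _ _ := by simp

/-- Right multiplication by `y` on normal forms. -/
noncomputable def rightY : Module.End k (NormalForm k) where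
  -- From z^n y = y z^n - n z^n x, which makes z d/dz appear, and from xy = z - yx.
  toFun v := (C X * v.1 + X * v.2, -(X * derivative v.1) - C X * v.2)
  map_add' _ _ := by ext1 <;> simp <;> ring
  map_smul' _ _ := by
    ext1
    · simp
    · simp [smul_sub]

/-- The right regular representation in terms of normal forms. -/
noncomputable def rightRegular : SuperJordanPlane k →ₐ[k] (Module.End k (NormalForm k))ᵐᵒᵖ :=
  lift ![MulOpposite.op (rightX k), MulOpposite.op (rightY k)]
    (by
      apply MulOpposite.unop_injective
      refine LinearMap.ext fun v => ?_
      simp [rightX])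
    (by
      apply MulOpposite.unop_injective
      refine LinearMap.ext fun v => ?_
      ext1 <;> simp [rightX, rightY] <;> ring)

variable {k}

/-- The normal form of an element. -/
noncomputable def normalForm (a : SuperJordanPlane k) : NormalForm k :=
  (rightRegular k a).unop (1, 0)

theorem normalForm_add (a b : SuperJordanPlane k) :
    normalForm (a + b) = normalForm a + normalForm b := by
  simp [normalForm]

theorem normalForm_zero : normalForm (0 : SuperJordanPlane k) = 0 := by
  simp [normalForm]

theorem normalForm_smul (c : k) (a : SuperJordanPlane k) :
    normalForm (c • a) = c • normalForm a := by
  simp [normalForm]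

theorem normalForm_one : normalForm (1 : SuperJordanPlane k) = (1, 0) := by
  simp [normalForm]

theorem normalForm_mul_x (a : SuperJordanPlane k) :
    normalForm (a * gen k 0) = (0, (normalForm a).1) := by
  simp [normalForm, rightRegular, rightX]

theorem normalForm_mul_y (a : SuperJordanPlane k) :
    normalForm (a * gen k 1) = (C X * (normalForm a).1 + X * (normalForm a).2,
      -(X * derivative (normalForm a).1) - C X * (normalForm a).2) := by
  simp [normalForm, rightRegular, rightY]

theorem normalForm_x : normalForm (gen k 0) = (0, 1) := by
  simpa [normalForm_one] using normalForm_mul_x (1 : SuperJordanPlane k)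

theorem normalForm_y : normalForm (gen k 1) = (C X, 0) := by
  simpa [normalForm_one] using normalForm_mul_y (1 : SuperJordanPlane k)

variable (k) in
/-- The element `z = x y + y x`. -/
noncomputable def anticommutator : SuperJordanPlane k := gen k 0 * gen k 1 + gen k 1 * gen k 0

theorem anticommutator_mul_x :
    anticommutator k * gen k 0 = gen k 0 * anticommutator k := by
  have h := gen_quadratic k
  simp only [anticommutator, add_mul, mul_add, mul_assoc, h]
  simp [← mul_assoc, h]

theorem anticommutator_mul_y :
    anticommutator k * gen k 1 = gen k 1 * anticommutator k - gen k 0 * anticommutator k := by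
  have h := gen_quadratic k
  have h' := gen_cubic k
  simp only [anticommutator, add_mul, mul_add, ← mul_assoc, h, h', zero_mul]
  abel

theorem anticommutator_pow_mul_x (n : ℕ) :
    anticommutator k ^ n * gen k 0 = gen k 0 * anticommutator k ^ n :=
  (Commute.pow_left (anticommutator_mul_x (k := k)) n)

theorem anticommutator_pow_mul_y (n : ℕ) :
    anticommutator k ^ n * gen k 1 =
      gen k 1 * anticommutator k ^ n - n * (anticommutator k ^ n * gen k 0) := by
  induction n with
  | zero => simp
  | succ n ih =>
    rw [anticommutator_pow_mul_x] at ih ⊢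
    rw [pow_succ, mul_assoc, anticommutator_mul_y, mul_sub, ← mul_assoc, ← mul_assoc, ih,
      anticommutator_pow_mul_x]
    push_cast
    noncomm_ring

/-- Evaluation of an ordered polynomial, powers of `y` to the left of powers of `z`. -/
noncomputable def ofPolynomial (p : k[X][X]) : SuperJordanPlane k :=
  p.eval₂ (aeval (gen k 1)).toRingHom (anticommutator k)

theorem ofPolynomial_add (p q : k[X][X]) :
    ofPolynomial (p + q) = ofPolynomial p + ofPolynomial q :=
  eval₂_add _ _

theorem ofPolynomial_neg (p : k[X][X]) : ofPolynomial (-p) = -ofPolynomial p :=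
  eval₂_neg _

theorem ofPolynomial_sub (p q : k[X][X]) :
    ofPolynomial (p - q) = ofPolynomial p - ofPolynomial q :=
  eval₂_sub _

theorem ofPolynomial_monomial (n : ℕ) (a : k[X]) :
    ofPolynomial (monomial n a) = aeval (gen k 1) a * anticommutator k ^ n :=
  eval₂_monomial _ _

theorem ofPolynomial_smul (c : k) (p : k[X][X]) : ofPolynomial (c • p) = c • ofPolynomial p := by
  induction p using Polynomial.induction_on' with
  | add p q hp hq => rw [smul_add, ofPolynomial_add, ofPolynomial_add, hp, hq, smul_add]
  | monomial n a =>
    rw [smul_monomial, ofPolynomial_monomial, ofPolynomial_monomial, map_smul, smul_mul_assoc]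

theorem ofPolynomial_mul_X (p : k[X][X]) :
    ofPolynomial (X * p) = ofPolynomial p * anticommutator k :=
  eval₂_X_mul _ _

theorem ofPolynomial_mul_y (p : k[X][X]) :
    ofPolynomial p * gen k 1 =
      ofPolynomial (C X * p) - ofPolynomial (X * derivative p) * gen k 0 := by
  induction p using Polynomial.induction_on' with
  | add p q hp hq =>
    simp only [map_add, mul_add, add_mul, ofPolynomial_add, hp, hq]
    abel
  | monomial n a =>
    have h : X * derivative (monomial n a) = monomial n (a * n) := by
      rw [derivative_monomial]
      cases n with
      | zero => simp
      | succ n => rw [X_mul_monomial, Nat.add_sub_cancel]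
    rw [C_mul_monomial, h, ofPolynomial_monomial, ofPolynomial_monomial, ofPolynomial_monomial,
      mul_assoc, anticommutator_pow_mul_y, mul_comm X a]
    simp only [map_mul, aeval_X, map_natCast, mul_sub, mul_assoc]

/-- The element with a given normal form. -/
noncomputable def ofNormalForm (v : NormalForm k) : SuperJordanPlane k :=
  ofPolynomial v.1 + ofPolynomial v.2 * gen k 0

theorem ofNormalForm_mul_x (v : NormalForm k) :
    ofNormalForm v * gen k 0 = ofNormalForm (rightX k v) := by
  simp [ofNormalForm, rightX, add_mul, mul_assoc, gen_quadratic, ofPolynomial]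

theorem ofNormalForm_mul_y (v : NormalForm k) :
    ofNormalForm v * gen k 1 = ofNormalForm (rightY k v) := by
  have h : gen k 0 * gen k 1 = anticommutator k - gen k 1 * gen k 0 := by
    simp [anticommutator]
  have hx := gen_quadratic k
  simp only [ofNormalForm, rightY, LinearMap.coe_mk, AddHom.coe_mk, add_mul, mul_assoc, h, mul_sub,
    ofPolynomial_add, ofPolynomial_sub, ofPolynomial_neg]
  rw [← mul_assoc _ (gen k 1) (gen k 0), ofPolynomial_mul_y, ofPolynomial_mul_y, ofPolynomial_mul_X]
  simp only [sub_mul, mul_assoc, hx, mul_zero, neg_mul, ofPolynomial_mul_X]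
  abel

/-- Evaluation intertwines the two right actions, as is checked on generators. At `v = (1, 0)` this
shows that an element is recovered from its normal form. -/
theorem ofNormalForm_mul (a : SuperJordanPlane k) (v : NormalForm k) :
    ofNormalForm v * a = ofNormalForm ((rightRegular k a).unop v) := by
  obtain ⟨w, rfl⟩ : ∃ w, mk k w = a := RingQuot.mkAlgHom_surjective k (Rel k) a
  induction w using FreeAlgebra.induction generalizing v with
  | grade0 r => 
    rw [AlgHom.commutes, AlgHom.commutes, ← Algebra.commutes, ← Algebra.smul_def,
      Algebra.algebraMap_eq_smul_one]
    simp [ofNormalForm, ofPolynomial_smul]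
  | grade1 i =>
    change _ * gen k i = ofNormalForm ((rightRegular k (gen k i)).unop v)
    fin_cases i
    · simpa [rightRegular] using ofNormalForm_mul_x v
    · simpa [rightRegular] using ofNormalForm_mul_y v
  | mul a b ha hb => simp [← mul_assoc, ha, hb]
  | add a b ha hb =>
    rw [map_add, mul_add, ha, hb]
    simp only [map_add, MulOpposite.unop_add, LinearMap.add_apply, ofNormalForm, Prod.fst_add,
      Prod.snd_add, ofPolynomial_add, add_mul]
    abel

theorem ofNormalForm_normalForm (a : SuperJordanPlane k) : ofNormalForm (normalForm a) = a := by
  rw [normalForm, ← ofNormalForm_mul]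
  simp [ofNormalForm, ofPolynomial]

theorem eq_zero_of_normalForm (a : SuperJordanPlane k) (h : normalForm a = 0) : a = 0 := by
  rw [← ofNormalForm_normalForm a, h]
  simp [ofNormalForm, ofPolynomial]

theorem exists_mul_x_of_mul_x_eq_zero (a : SuperJordanPlane k) (h : a * gen k 0 = 0) :
    ∃ b, a = b * gen k 0 := by
  have h1 := normalForm_mul_x a
  rw [h, normalForm_zero] at h1
  have h2 : (normalForm a).1 = 0 := (congrArg Prod.snd h1).symm
  refine ⟨ofPolynomial (normalForm a).2, ?_⟩
  conv_lhs => rw [← ofNormalForm_normalForm a]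
  rw [ofNormalForm, h2]
  simp [ofPolynomial]

/-- On normal forms, y sends (0, p) to (zp, -yp), and k[y, z] is a domain. -/
theorem mul_x_eq_zero_of_mul_x_mul_y_eq_zero (a : SuperJordanPlane k)
    (h : a * gen k 0 * gen k 1 = 0) : a * gen k 0 = 0 := by
  have h1 := normalForm_mul_y (a * gen k 0)
  rw [h, normalForm_zero, normalForm_mul_x] at h1
  have h2 := congrArg Prod.fst h1
  simp only [mul_zero, zero_add, Prod.fst_zero, zero_eq_mul, X_ne_zero, false_or] at h2
  exact eq_zero_of_normalForm _ (by rw [normalForm_mul_x, h2]; rfl)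

theorem exists_of_mul_x_add_mul_y_eq_zero (a b : SuperJordanPlane k)
    (h : a * gen k 0 + b * gen k 1 = 0) :
    ∃ c d, a = c * gen k 0 + d * (gen k 1 * gen k 1 - gen k 0 * gen k 1) ∧
      b = -(d * (gen k 0 * gen k 1)) := by
  have h1 := congrArg normalForm h
  rw [normalForm_add, normalForm_mul_x, normalForm_mul_y, normalForm_zero] at h1
  have h2 := congrArg Prod.fst h1
  simp only [Prod.fst_add, zero_add, Prod.fst_zero] at h2
  -- The first component reads y b₁ + z b₂ = 0. As z is prime and does not divide y, b₁ = zt and b₂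
  -- = -yt, which is the normal form of t·xy.
  have hZ : Prime (X : k[X][X]) := prime_X
  have hd : (X : k[X][X]) ∣ (normalForm b).1 := by
    have : (X : k[X][X]) ∣ C X * (normalForm b).1 :=
      ⟨-(normalForm b).2, by linear_combination h2⟩
    refine (hZ.dvd_or_dvd this).resolve_left fun h => ?_
    rw [X_dvd_iff, coeff_C_zero] at h
    exact X_ne_zero h
  obtain ⟨t, ht⟩ := hd
  have hs : (normalForm b).2 = -(C X * t) := by
    apply mul_left_cancel₀ hZ.ne_zero
    rw [ht] at h2
    linear_combination h2
  have hb : b = -(ofPolynomial (-t) * (gen k 0 * gen k 1)) := by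
    have : ofPolynomial t = ofNormalForm (t, 0) := by simp [ofNormalForm, ofPolynomial]
    rw [ofPolynomial_neg, neg_mul, neg_neg, this, ← mul_assoc, ofNormalForm_mul_x,
      ofNormalForm_mul_y]
    conv_lhs => rw [← ofNormalForm_normalForm b]
    congr 1
    ext1
    · simp [rightX, rightY, ht]
    · simp [rightX, rightY, hs]
  -- Subtracting the multiple of the cubic syzygy that accounts for b leaves an element killed by x.
  obtain ⟨c, hc⟩ := exists_mul_x_of_mul_x_eq_zero
    (a - ofPolynomial (-t) * (gen k 1 * gen k 1 - gen k 0 * gen k 1)) (by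
      have := gen_cubic k
      rw [hb] at h
      rw [sub_mul, mul_assoc, sub_mul, this, ← h]
      noncomm_ring)
  exact ⟨c, _, by rw [← hc]; abel, hb⟩

end SuperJordanPlane

/-! ### Yoneda products and scalars in degree zero. -/

section Ext

variable {C : Type u} [Category.{v} C] [Abelian C] [HasExt.{w} C]

/-- Precomposing with a Yoneda product is multiplying on the left in the Yoneda algebra. -/
theorem SelfExt.of_comp (X : C) {m n l : ℕ} (α : SelfExt X m) (β : SelfExt X n) (h : m + n = l) :
    DirectSum.of (SelfExt X) l (Ext.comp α β h) =
      DirectSum.of (SelfExt X) n β * DirectSum.of (SelfExt X) m α := by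
  obtain rfl : l = n + m := by omega
  rw [DirectSum.of_mul_of]
  rfl

end Ext

section TrivialModule

variable {k : Type u} [Field k] {A : Type u} [Ring A] [Algebra k A] (ε : A →ₐ[k] k)

/-- The augmentation as a map of left modules. -/
noncomputable def augmentationMap : A →ₗ[A] trivialModule ε where
  toFun a := (ε a : k)
  map_add' a b := map_add ε a b
  map_smul' a b := map_mul ε a b

theorem augmentationMap_surjective : Function.Surjective (augmentationMap ε) := fun c =>
  ⟨algebraMap k A c, ε.commutes c⟩

/-- An endomorphism of the trivial module is determined by the image of 1. -/
theorem selfExt_trivialModule_zero (α : SelfExt.{u} (trivialModule ε) 0) :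
    ∃ c : k, α = c • Ext.mk₀ (𝟙 (trivialModule ε)) := by
  obtain ⟨f, rfl⟩ := (Ext.mk₀_bijective _ _).2 α
  obtain ⟨c, hc⟩ := (⟨f.hom (1 : k), rfl⟩ : ∃ c : k, f.hom (1 : k) = c)
  refine ⟨c, ?_⟩
  rw [← Ext.mk₀_smul]
  congr 1
  ext s
  obtain ⟨a, rfl⟩ := augmentationMap_surjective ε s
  have h1 : augmentationMap ε a = a • augmentationMap ε 1 := by
    rw [← map_smul, smul_eq_mul, mul_one]
  have h2 : augmentationMap ε 1 = (1 : k) := map_one ε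
  rw [h1, map_smul, h2]
  refine (congrArg (a • ·) hc).trans ?_
  change ε a * c = ε (algebraMap k A c) * (ε a * 1)
  rw [AlgHom.commutes, mul_one, mul_comm]
  rfl

end TrivialModule

/-! ### The resolution of k and generation of the Yoneda algebra. -/

namespace SuperJordanPlane

variable {k : Type u} [Field k]

local notation "A" => SuperJordanPlane k
local notation "𝕜" => trivialModule (augmentation k)

/-- The linear map from `A × A` sending the basis to `u` and `v`. -/
noncomputable def ofPair {M : Type*} [AddCommGroup M] [Module A M] (u v : M) : A × A →ₗ[A] M :=
  (LinearMap.toSpanSingleton A M u).coprod (LinearMap.toSpanSingleton A M v)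

theorem ofPair_apply {M : Type*} [AddCommGroup M] [Module A M] (u v : M) (p : A × A) :
    ofPair u v p = p.1 • u + p.2 • v := by
  simp [ofPair]

theorem augmentation_gen (i : Fin 2) : augmentation k (gen k i) = 0 := by
  simp [augmentation]

/-- The projection to `A / (y)`, the algebra of dual numbers. -/
noncomputable def toDualNumber : A →ₐ[k] DualNumber k :=
  lift ![DualNumber.eps, 0] (by simp) (by simp)

theorem fst_toDualNumber (a : A) : (toDualNumber a).fst = augmentation k a := by
  have : (TrivSqZeroExt.fstHom k k k).comp toDualNumber = augmentation k := by
    apply hom_ext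
    intro i
    fin_cases i <;> simp [toDualNumber, augmentation]
  exact DFunLike.congr_fun this a

variable (k) in
/-- The functional on the augmentation ideal with value `1` on `x` and `0` on `y`. -/
noncomputable def xFunctional :
    LinearMap.ker (augmentationMap (augmentation k)) →ₗ[SuperJordanPlane k]
      trivialModule (augmentation k) where
  toFun a := (toDualNumber (a : A)).snd
  map_add' a b := by
    simp
    rfl
  map_smul' a b := by
    obtain ⟨b, hb⟩ := b
    have hb' : (toDualNumber b).fst = 0 := by rw [fst_toDualNumber]; exact hb
    change (toDualNumber (a * b)).snd = augmentation k a * (toDualNumber b).snd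
    simp [hb', fst_toDualNumber]

/-- The periodic part of the differential of the minimal resolution of the trivial module. -/
noncomputable def periodicMap : A × A →ₗ[A] A × A :=
  ofPair (gen k 0, 0) (gen k 1 * gen k 1 - gen k 0 * gen k 1, -gen k 0)

/-- The second differential of the minimal resolution, given by the relations. -/
noncomputable def relationMap : A × A →ₗ[A] A × A :=
  ofPair (gen k 0, 0) (gen k 1 * gen k 1 - gen k 0 * gen k 1, -(gen k 0 * gen k 1))

variable (k) in
/-- The first differential of the minimal resolution, given by the generators. -/
noncomputable def generatorMap : A × A →ₗ[A] A := ofPair (gen k 0) (gen k 1)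

/-- Both sides equal xy². This commutation makes `periodicMap` square to zero. -/
theorem cubic_mul_x :
    (gen k 1 * gen k 1 - gen k 0 * gen k 1) * gen k 0 =
      gen k 0 * (gen k 1 * gen k 1 - gen k 0 * gen k 1) := by
  rw [sub_mul, gen_cubic, mul_sub, ← mul_assoc, ← mul_assoc, gen_quadratic]
  simp

theorem exists_periodicMap (p : A × A)
    (h1 : p.1 * gen k 0 + p.2 * (gen k 1 * gen k 1 - gen k 0 * gen k 1) = 0)
    (h2 : p.2 * gen k 0 = 0) : ∃ q, periodicMap q = p := by
  obtain ⟨b, hb⟩ := exists_mul_x_of_mul_x_eq_zero _ h2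
  obtain ⟨a, ha⟩ := exists_mul_x_of_mul_x_eq_zero
    (p.1 + b * (gen k 1 * gen k 1 - gen k 0 * gen k 1)) (by
      rw [add_mul, mul_assoc, cubic_mul_x, ← h1, hb]
      noncomm_ring)
  -- The second coordinate of `periodicMap` is -x, whence the sign of b.
  refine ⟨(a, -b), ?_⟩
  ext1
  · simp [periodicMap, ofPair_apply, ← ha]
  · simp [periodicMap, ofPair_apply, hb]

theorem ker_periodicMap :
    LinearMap.ker (periodicMap (k := k)) = LinearMap.range (periodicMap (k := k)) := by
  ext p
  constructor
  · intro h
    have h : periodicMap p = 0 := h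
    simp only [periodicMap, ofPair_apply, Prod.ext_iff] at h
    exact exists_periodicMap p (by simpa using h.1) (by simpa using h.2)
  · rintro ⟨q, rfl⟩
    have hx := gen_quadratic k
    rw [LinearMap.mem_ker]
    simp only [periodicMap, ofPair_apply]
    ext1
    · simp [add_mul, mul_assoc, hx, cubic_mul_x]
    · simp [mul_assoc, hx]

/-- Only the last entry differs from `periodicMap`: xy in place of x. Right multiplication by y is
injective on Ax, so the two kernels agree. -/
theorem ker_relationMap :
    LinearMap.ker (relationMap (k := k)) = LinearMap.range (periodicMap (k := k)) := by
  ext p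
  constructor
  · intro h
    have h : relationMap p = 0 := h
    simp only [relationMap, ofPair_apply, Prod.ext_iff] at h
    exact exists_periodicMap p (by simpa using h.1)
      (mul_x_eq_zero_of_mul_x_mul_y_eq_zero _ (by simpa [mul_assoc] using h.2))
  · rintro ⟨q, rfl⟩
    have hx := gen_quadratic k
    have hx' (a : A) : gen k 0 * (gen k 0 * a) = 0 := by rw [← mul_assoc, hx, zero_mul]
    rw [LinearMap.mem_ker]
    simp only [periodicMap, relationMap, ofPair_apply]
    ext1
    · simp [add_mul, mul_assoc, hx, cubic_mul_x]
    · simp [mul_assoc, hx']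

theorem ker_generatorMap :
    LinearMap.ker (generatorMap k) = LinearMap.range (relationMap (k := k)) := by
  ext p
  constructor
  · intro h
    have h : generatorMap k p = 0 := h
    simp only [generatorMap, ofPair_apply] at h
    obtain ⟨c, d, h1, h2⟩ := exists_of_mul_x_add_mul_y_eq_zero _ _ h
    refine ⟨(c, d), ?_⟩
    ext1
    · simp [relationMap, ofPair_apply, h1]
    · simp [relationMap, ofPair_apply, h2]
  · rintro ⟨q, rfl⟩
    have hx := gen_quadratic k
    have h := gen_cubic k
    rw [LinearMap.mem_ker]
    simp only [generatorMap, relationMap, ofPair_apply, smul_eq_mul]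
    simp only [Prod.fst_add, Prod.smul_fst, Prod.snd_add, Prod.smul_snd, smul_eq_mul, mul_zero,
      zero_add, add_mul, mul_assoc, hx, sub_mul, mul_neg, neg_mul, mul_sub]
    rw [← mul_assoc (gen k 1), h]
    noncomm_ring

theorem ker_augmentationMap :
    LinearMap.ker (augmentationMap (augmentation k)) = LinearMap.range (generatorMap k) := by
  apply le_antisymm
  · suffices h : ∀ a : A, a - algebraMap k A (augmentation k a) ∈ LinearMap.range (generatorMap k) by
      intro a ha
      have ha : augmentation k a = 0 := ha
      simpa [ha] using h a
    intro a
    obtain ⟨w, rfl⟩ : ∃ w, mk k w = a := RingQuot.mkAlgHom_surjective k (Rel k) a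
    induction w using FreeAlgebra.induction with
    | grade0 r => simp
    | grade1 i =>
      change gen k i - algebraMap k A (augmentation k (gen k i)) ∈ _
      rw [augmentation_gen, map_zero, sub_zero]
      fin_cases i
      · exact ⟨(1, 0), by simp [generatorMap, ofPair_apply]⟩
      · exact ⟨(0, 1), by simp [generatorMap, ofPair_apply]⟩
    | mul a b ha hb =>
      -- ab - ε(ab) = a(b - ε(b)) + ε(b)(a - ε(a)).
      convert add_mem (Submodule.smul_mem _ (mk k a) hb) (Submodule.smul_mem _
        (algebraMap k A (augmentation k (mk k b))) ha) using 1
      rw [smul_eq_mul, smul_eq_mul, mul_sub, mul_sub, ← Algebra.commutes (augmentation k (mk k b)),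
        map_mul, map_mul, ← map_mul (algebraMap k A), mul_comm (augmentation k (mk k a)),
        sub_add_sub_cancel, map_mul]
    | add a b ha hb =>
      convert add_mem ha hb using 1
      simp only [map_add]
      abel
  · rintro _ ⟨p, rfl⟩
    change augmentation k _ = 0
    simp [generatorMap, ofPair_apply, augmentation_gen]

variable (k) in
/-- The class in `Ext¹(k, k)` dual to `x`. -/
noncomputable def xClass : SelfExt.{u} 𝕜 1 :=
  (LinearMap.shortExact_shortComplexKer (augmentationMap_surjective (augmentation k))).extClass.comp
    (Ext.mk₀ (ModuleCat.ofHom (xFunctional k))) (add_zero 1)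

/-- A map from the extension of Q by the kernel of g to the extension A₊ → A → k, inducing φ through
`xFunctional` on the left, moves φ across the extension class by naturality. -/
theorem exists_extClass_comp_mk₀ {Q : Type u} [AddCommGroup Q] [Module A Q] (g : A × A →ₗ[A] Q)
    (hg : Function.Surjective g)
    (hker : LinearMap.ker g = LinearMap.range (periodicMap (k := k)))
    (φ : ModuleCat.of A (LinearMap.ker g) ⟶ 𝕜) :
    ∃ ψ : ModuleCat.of A Q ⟶ 𝕜,
      (LinearMap.shortExact_shortComplexKer hg).extClass.comp (Ext.mk₀ φ) (add_zero 1) =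
        (Ext.mk₀ ψ).comp (xClass k) (zero_add 1) := by
  have hmem (p : A × A) : periodicMap p ∈ LinearMap.ker g := by rw [hker]; exact ⟨p, rfl⟩
  let π : A × A →ₗ[A] LinearMap.ker g := periodicMap.codRestrict _ hmem
  have hπ : Function.Surjective π := by
    rintro ⟨p, hp⟩
    rw [hker] at hp
    obtain ⟨q, rfl⟩ := hp
    exact ⟨q, rfl⟩
  obtain ⟨c, hc⟩ : ∃ c : k, φ.hom (π (1, 0)) = c := ⟨_, rfl⟩
  obtain ⟨d, hd⟩ : ∃ d : k, φ.hom (π (0, 1)) = d := ⟨_, rfl⟩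
  -- The images (x, 0) and (y² - xy, -x) of the basis go to cx and c(y² - xy) + dx, whose
  -- x-coefficients are the prescribed c and d.
  let τ₂ : A × A →ₗ[A] A := ofPair (algebraMap k A c) (-algebraMap k A d)
  have hτ (m : LinearMap.ker g) : augmentationMap (augmentation k) (τ₂ m) = 0 := by
    obtain ⟨p, rfl⟩ := hπ m
    change augmentation k (ofPair _ _ (periodicMap p)) = 0
    simp [ofPair_apply, periodicMap, augmentation_gen]
  let τ₁ : LinearMap.ker g →ₗ[A] LinearMap.ker (augmentationMap (augmentation k)) :=
    (τ₂.comp (LinearMap.ker g).subtype).codRestrict _ hτ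
  have hS := LinearMap.shortExact_shortComplexKer hg
  have := hS.epi_g
  obtain ⟨ψ, hψ⟩ : ∃ ψ : ModuleCat.of A Q ⟶ 𝕜, g.shortComplexKer.g ≫ ψ =
      ModuleCat.ofHom ((augmentationMap (augmentation k)).comp τ₂) :=
    ⟨_, hS.exact.g_desc _ (ModuleCat.hom_ext (LinearMap.ext hτ))⟩
  let τ : g.shortComplexKer ⟶ (augmentationMap (augmentation k)).shortComplexKer :=
    { τ₁ := ModuleCat.ofHom τ₁
      τ₂ := ModuleCat.ofHom τ₂
      τ₃ := ψ
      comm₁₂ := rfl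
      comm₂₃ := hψ.symm }
  have hφ : ModuleCat.ofHom τ₁ ≫ ModuleCat.ofHom (xFunctional k) = φ := by
    have := (ModuleCat.epi_iff_surjective (ModuleCat.ofHom π)).mpr hπ
    rw [← cancel_epi (ModuleCat.ofHom π)]
    apply ModuleCat.hom_ext
    have h1 : (xFunctional k) (τ₁ (π (1, 0))) = φ.hom (π (1, 0)) := by
      rw [hc]
      change (toDualNumber (τ₂ (periodicMap (1, 0)))).snd = c
      simp [τ₂, ofPair_apply, periodicMap, toDualNumber]
      rfl
    have h2 : (xFunctional k) (τ₁ (π (0, 1))) = φ.hom (π (0, 1)) := by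
      rw [hd]
      change (toDualNumber (τ₂ (periodicMap (0, 1)))).snd = d
      simp [τ₂, ofPair_apply, periodicMap, toDualNumber]
      rfl
    refine LinearMap.prod_ext (LinearMap.ext_ring ?_) (LinearMap.ext_ring ?_)
    · exact h1
    · exact h2
  refine ⟨ψ, ?_⟩
  have key := ShortComplex.ShortExact.extClass_naturality (LinearMap.shortExact_shortComplexKer hg)
    (LinearMap.shortExact_shortComplexKer (augmentationMap_surjective (augmentation k))) τ
  rw [xClass, ← Ext.comp_assoc (a₁₂ := 1) _ _ _ (zero_add 1) (add_zero 1) (by omega)]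
  erw [← key]
  rw [Ext.comp_assoc (a₂₃ := 0) _ _ _ (add_zero 1) (zero_add 0) (by omega), Ext.mk₀_comp_mk₀]
  erw [hφ]

/-- Dimension shifting replaces Q by the kernel of g, which is again a quotient of A² with the image
of `periodicMap` as kernel. Hence the induction quantifies over Q. -/
theorem exists_comp_xClass (n : ℕ) : ∀ {Q : Type u} [AddCommGroup Q] [Module A Q]
    (g : A × A →ₗ[A] Q) (_ : Function.Surjective g)
    (_ : LinearMap.ker g = LinearMap.range (periodicMap (k := k)))
    (β : Ext.{u} (ModuleCat.of A Q) 𝕜 (n + 1)),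
    ∃ β' : Ext.{u} (ModuleCat.of A Q) 𝕜 n, β = β'.comp (xClass k) rfl := by
  induction n with
  | zero =>
    intro Q _ _ g hg hker β
    obtain ⟨γ, hγ⟩ := precomp_extClass_surjective_of_projective_X₂ _
      (LinearMap.shortExact_shortComplexKer hg) 0 β
    obtain ⟨φ, rfl⟩ := (Ext.mk₀_bijective _ _).2 γ
    obtain ⟨ψ, hψ⟩ := exists_extClass_comp_mk₀ g hg hker φ
    exact ⟨Ext.mk₀ ψ, hγ.symm.trans hψ⟩
  | succ n ih =>
    intro Q _ _ g hg hker β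
    obtain ⟨γ, hγ⟩ := precomp_extClass_surjective_of_projective_X₂ _
      (LinearMap.shortExact_shortComplexKer hg) (n + 1) β
    have hmem (p : A × A) : periodicMap p ∈ LinearMap.ker g := by rw [hker]; exact ⟨p, rfl⟩
    obtain ⟨γ', rfl⟩ := ih (periodicMap.codRestrict (LinearMap.ker g) hmem)
      (by
        rintro ⟨p, hp⟩
        rw [hker] at hp
        obtain ⟨q, rfl⟩ := hp
        exact ⟨q, rfl⟩)
      (by rw [LinearMap.ker_codRestrict, ker_periodicMap]) γ
    refine ⟨(LinearMap.shortExact_shortComplexKer hg).extClass.comp γ' (add_comm 1 n), ?_⟩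
    rw [Ext.comp_assoc _ _ _ _ rfl (by omega)]
    exact hγ.symm

/-- Two dimension shifts pass from k to the image of `relationMap`, where the resolution becomes
periodic. -/
theorem selfExt_exists_comp_xClass (n : ℕ) (α : SelfExt.{u} 𝕜 (n + 3)) :
    ∃ α' : SelfExt.{u} 𝕜 (n + 2), α = Ext.comp α' (xClass k) rfl := by
  have hG (p : A × A) : generatorMap k p ∈ LinearMap.ker (augmentationMap (augmentation k)) := by
    rw [ker_augmentationMap]; exact ⟨p, rfl⟩
  have hR (p : A × A) : relationMap p ∈ LinearMap.ker
      ((generatorMap k).codRestrict (LinearMap.ker (augmentationMap (augmentation k))) hG) := by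
    rw [LinearMap.ker_codRestrict, ker_generatorMap]; exact ⟨p, rfl⟩
  have h0 := LinearMap.shortExact_shortComplexKer (augmentationMap_surjective (augmentation k))
  have h1 := LinearMap.shortExact_shortComplexKer (f := (generatorMap k).codRestrict _ hG) (by
    rintro ⟨p, hp⟩
    rw [ker_augmentationMap] at hp
    obtain ⟨q, rfl⟩ := hp
    exact ⟨q, rfl⟩)
  obtain ⟨β, hβ⟩ := precomp_extClass_surjective_of_projective_X₂ _ h0 (n + 2) α
  obtain ⟨γ, hγ⟩ := precomp_extClass_surjective_of_projective_X₂ _ h1 (n + 1) β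
  obtain ⟨γ', rfl⟩ := exists_comp_xClass n (relationMap.codRestrict _ hR) (by
    rintro ⟨p, hp⟩
    rw [LinearMap.ker_codRestrict, ker_generatorMap] at hp
    obtain ⟨q, rfl⟩ := hp
    exact ⟨q, rfl⟩) (by rw [LinearMap.ker_codRestrict, ker_relationMap]) γ
  refine ⟨h0.extClass.comp (h1.extClass.comp γ' (add_comm 1 n)) (add_comm 1 (n + 1)), ?_⟩
  rw [Ext.comp_assoc _ _ _ _ rfl (by omega), Ext.comp_assoc _ _ _ _ rfl (by omega)]
  exact hβ.symm.trans (congrArg (fun b => h0.extClass.comp b _) hγ.symm)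

variable (k) in
theorem isK2 : IsK2 (augmentation k) := by
  have key (n : ℕ) (α : SelfExt.{u} (trivialModule (augmentation k)) n) :
      DirectSum.of (SelfExt.{u} (trivialModule (augmentation k))) n α ∈ Algebra.adjoin k
        (Set.range (DirectSum.of (SelfExt.{u} (trivialModule (augmentation k))) 1) ∪
          Set.range (DirectSum.of (SelfExt.{u} (trivialModule (augmentation k))) 2)) := by
    induction n with
    | zero =>
      obtain ⟨c, rfl⟩ := selfExt_trivialModule_zero _ α
      exact Subalgebra.algebraMap_mem _ c
    | succ n ih =>
      match n with
      | 0 => exact Algebra.subset_adjoin (Or.inl ⟨α, rfl⟩)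
      | 1 => exact Algebra.subset_adjoin (Or.inr ⟨α, rfl⟩)
      | n + 2 =>
        obtain ⟨α', rfl⟩ := selfExt_exists_comp_xClass n α
        rw [SelfExt.of_comp]
        exact mul_mem (Algebra.subset_adjoin (Or.inl ⟨_, rfl⟩)) (ih α')
  rw [IsK2, eq_top_iff]
  intro a _
  induction a using DirectSum.induction_on with
  | zero => exact zero_mem _
  | of n α => exact key n α
  | add a b ha hb => exact add_mem (ha trivial) (hb trivial)

end SuperJordanPlane

/-! ### Failure of N-Koszulity. -/

namespace SuperJordanPlane

variable {k : Type u} [Field k]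

local notation "A" => SuperJordanPlane k

theorem mem_component_zero {a : A} (h : a ∈ component k 0) : ∃ r : k, a = algebraMap k A r := by
  rw [component, pow_zero, Submodule.mem_one] at h
  obtain ⟨r, rfl⟩ := h
  exact ⟨r, rfl⟩

theorem mem_component_one {a : A} (h : a ∈ component k 1) :
    ∃ r s : k, a = r • gen k 0 + s • gen k 1 := by
  rw [component, pow_one, Submodule.mem_span_range_iff_exists_fun] at h
  obtain ⟨c, rfl⟩ := h
  exact ⟨c 0, c 1, by simp⟩

open Polynomial in
theorem smul_gen_add_smul_gen_injective {r s r' s' : k}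
    (h : r • gen k 0 + s • gen k 1 = r' • gen k 0 + s' • gen k 1) : r = r' ∧ s = s' := by
  have h := congrArg normalForm h
  simp only [normalForm_add, normalForm_smul, normalForm_x, normalForm_y, Prod.ext_iff] at h
  obtain ⟨h1, h2⟩ := h
  refine ⟨by simpa [smul_eq_C_mul] using congrArg (fun p => (p.coeff 0).coeff 0) h2, ?_⟩
  simpa [smul_eq_C_mul] using congrArg (fun p => (p.coeff 0).coeff 1) h1

theorem gen_zero_ne_zero : gen k 0 ≠ 0 := by
  intro h
  have := smul_gen_add_smul_gen_injective (k := k) (r := 1) (s := 0) (r' := 0) (s' := 0)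
    (by simp [h])
  simp at this

theorem gen_mul_gen_ne_zero : gen k 0 * gen k 1 ≠ 0 := by
  intro h
  have h := congrArg (fun a => (normalForm a).1) h
  simp [normalForm_mul_y, normalForm_x, normalForm_zero] at h

-- For b = r'x + s'y the first component of the normal form is s'y² + r'z: up to scalar, x² is the
-- only quadratic relation.
open Polynomial in
theorem eq_zero_of_mem_component_one {a b : A} (ha : a ∈ component k 1) (hb : b ∈ component k 1)
    (h : a * gen k 0 + b * gen k 1 = 0) : b = 0 := by
  obtain ⟨r, s, rfl⟩ := mem_component_one ha
  obtain ⟨r', s', rfl⟩ := mem_component_one hb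
  have h := congrArg (fun a => (normalForm a).1) h
  simp only [normalForm_add, normalForm_smul, normalForm_x, normalForm_y, normalForm_mul_x,
    normalForm_mul_y, normalForm_zero, Prod.fst_add] at h
  have h1 : r' = 0 := by
    simpa [smul_eq_C_mul, coeff_X, coeff_C] using congrArg (fun p => (p.coeff 1).coeff 0) h
  have h2 : s' = 0 := by
    simpa [smul_eq_C_mul] using congrArg (fun p => (p.coeff 0).coeff 2) h
  simp [h1, h2]

theorem map_single_eq_mul {ι : Type*} (L : (ι →₀ A) →ₗ[A] A) (i : ι) (b : A) :
    L (Finsupp.single i b) = b * L (Finsupp.single i 1) := by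
  rw [← smul_eq_mul b, ← map_smul, Finsupp.smul_single, smul_eq_mul, mul_one]

section Homogeneous

variable {ι : Type*} {n : ℕ} (L : (ι →₀ SuperJordanPlane k) →ₗ[SuperJordanPlane k]
  SuperJordanPlane k) (hL : ∀ i, L (Finsupp.single i 1) ∈ component k n)
include hL

theorem proj_map_add (m : ℕ) (v : ι →₀ SuperJordanPlane k) :
    GradedRing.proj (component k) (m + n) (L v) =
      L (v.mapRange (GradedRing.proj (component k) m) (map_zero _)) := by
  induction v using Finsupp.induction_linear with
  | zero => simp
  | add f g hf hg => rw [map_add, map_add, hf, hg, Finsupp.mapRange_add (by simp), map_add]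
  | single i b =>
    rw [Finsupp.mapRange_single, map_single_eq_mul L i b,
      map_single_eq_mul L i (GradedRing.proj _ m b), GradedRing.proj_apply,
      GradedRing.proj_apply, DirectSum.coe_decompose_mul_add_of_right_mem _ (hL i)]

theorem proj_map_of_lt {m : ℕ} (hm : m < n) (v : ι →₀ SuperJordanPlane k) :
    GradedRing.proj (component k) m (L v) = 0 := by
  induction v using Finsupp.induction_linear with
  | zero => simp
  | add f g hf hg => rw [map_add, map_add, hf, hg, add_zero]
  | single i b =>
    rw [map_single_eq_mul, GradedRing.proj_apply, DirectSum.coe_decompose_mul_of_right_mem_of_not_le _ (hL i)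
      (by omega)]

end Homogeneous

/-- L raises degree by exactly one, so the degree-zero part of u already has the same image. -/
theorem exists_map_eq_of_mem_component_one {ι : Type*} (L : (ι →₀ A) →ₗ[A] A)
    (hL : ∀ i, L (Finsupp.single i 1) ∈ component k 1) (u : ι →₀ A) (hu : L u ∈ component k 1) :
    ∃ u', (∀ i, u' i ∈ component k 0) ∧ L u' = L u := by
  refine ⟨u.mapRange (GradedRing.proj (component k) 0) (map_zero _), fun i => ?_, ?_⟩
  · rw [Finsupp.mapRange_apply, GradedRing.proj_apply]
    exact SetLike.coe_mem _
  · rw [← proj_map_add L hL, GradedRing.proj_apply]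
    exact DirectSum.decompose_of_mem_same _ hu

theorem linearCombination_mem_component {ι : Type*} (c : ι → k) {n : ℕ} (v : ι →₀ A)
    (hv : ∀ i, v i ∈ component k n) :
    Finsupp.linearCombination A (fun i => algebraMap k A (c i)) v ∈ component k n := by
  rw [Finsupp.linearCombination_apply]
  refine Submodule.sum_mem _ fun i _ => ?_
  dsimp only
  rw [smul_eq_mul, ← Algebra.commutes, ← Algebra.smul_def]
  exact Submodule.smul_mem _ _ (hv i)

/-- A presentation of the augmentation ideal by generators of degree one cannot have all its
relations in a single degree. -/
theorem not_exact_of_homogeneous {ι κ : Type*} (L : (ι →₀ A) →ₗ[A] A)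
    (d : (κ →₀ A) →ₗ[A] (ι →₀ A)) {n : ℕ} (hn : n ≠ 0)
    (hL : ∀ i, L (Finsupp.single i 1) ∈ component k 1)
    (hd : ∀ i j, d (Finsupp.single i 1) j ∈ component k n)
    (hx : ∃ u, L u = gen k 0) (hy : ∃ v, L v = gen k 1) : ¬ Function.Exact d L := by
  intro hexact
  obtain ⟨u, hu⟩ := hx
  obtain ⟨v, hv⟩ := hy
  obtain ⟨u, hu0, hu'⟩ := exists_map_eq_of_mem_component_one L hL u (hu ▸ gen_mem k 0)
  obtain ⟨v, hv0, hv'⟩ := exists_map_eq_of_mem_component_one L hL v (hv ▸ gen_mem k 1)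
  rw [hu] at hu'
  rw [hv] at hv'
  obtain rfl | hn : n = 1 ∨ 1 < n := by omega
  -- Quadratic relations only. Splitting L as f·x + g·y, every syzygy in the image of d has g = 0.
  · choose α β hαβ using fun i => mem_component_one (hL i)
    let f := Finsupp.linearCombination A (fun i => algebraMap k A (α i))
    let g := Finsupp.linearCombination A (fun i => algebraMap k A (β i))
    have hfg (w : ι →₀ A) : f w * gen k 0 + g w * gen k 1 = L w := by
      have : (generatorMap k).comp (f.prod g) = L := by
        ext i
        simp [generatorMap, ofPair_apply, f, g, hαβ, Algebra.smul_def]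
      rw [← this]
      simp [generatorMap, ofPair_apply]
    have hgd : g.comp d = 0 := by
      ext i
      refine eq_zero_of_mem_component_one (linearCombination_mem_component α _ (hd i))
        (linearCombination_mem_component β _ (hd i)) ?_
      exact (hfg _).trans (hexact.apply_apply_eq_zero _)
    obtain ⟨r, hr⟩ := mem_component_zero (linearCombination_mem_component α _ hu0)
    obtain ⟨s, hs⟩ := mem_component_zero (linearCombination_mem_component β _ hu0)
    obtain ⟨r', hr'⟩ := mem_component_zero (linearCombination_mem_component α _ hv0)
    obtain ⟨s', hs'⟩ := mem_component_zero (linearCombination_mem_component β _ hv0)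
    have hgu : g u = 0 := by
      have h := hfg u
      simp only [f, g] at h ⊢
      rw [hr, hs, ← Algebra.smul_def, ← Algebra.smul_def, hu'] at h
      rw [hs, (smul_gen_add_smul_gen_injective (s := s) (r' := 1) (s' := 0) (by simpa using h)).2,
        map_zero]
    have hgv : g v = 1 := by
      have h := hfg v
      simp only [f, g] at h ⊢
      rw [hr', hs', ← Algebra.smul_def, ← Algebra.smul_def, hv'] at h
      rw [hs', (smul_gen_add_smul_gen_injective (s := s') (r' := 0) (s' := 1) (by simpa using h)).2,
        map_one]
    -- The lift of the cubic relation is a syzygy with g = -xy, which is nonzero.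
    obtain ⟨z, hz⟩ := (hexact ((gen k 1 * gen k 1 - gen k 0 * gen k 1) • u -
      (gen k 0 * gen k 1) • v)).1 (by
        rw [map_sub, map_smul, map_smul, hu', hv', smul_eq_mul, smul_eq_mul, cubic_mul_x, mul_sub,
          ← mul_assoc, ← mul_assoc, gen_quadratic]
        simp)
    have h := LinearMap.congr_fun hgd z
    rw [LinearMap.comp_apply, hz, map_sub, map_smul, map_smul, hgu, hgv] at h
    exact gen_mul_gen_ne_zero (k := k) (by simpa using h)
  -- Relations of higher degree only. The lift of x² = 0 has coordinates of degree 1 < n, so it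
  -- cannot be in the image of d unless u = 0.
  · obtain ⟨z, hz⟩ := (hexact (gen k 0 • u)).1 (by
      rw [map_smul, hu', smul_eq_mul, gen_quadratic])
    have hu0' : u = 0 := by
      ext i
      obtain ⟨r, hr⟩ := mem_component_zero (hu0 i)
      have h := proj_map_of_lt ((Finsupp.lapply i).comp d) (fun j => hd j i) hn z
      rw [LinearMap.comp_apply, hz, Finsupp.lapply_apply, Finsupp.smul_apply, hr, smul_eq_mul,
        ← Algebra.commutes, ← Algebra.smul_def, GradedRing.proj_apply,
        DirectSum.decompose_of_mem_same _ (Submodule.smul_mem _ _ (gen_mem k 0))] at h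
      rw [hr, (smul_eq_zero.1 h).resolve_right gen_zero_ne_zero, map_zero, Finsupp.zero_apply]
    exact gen_zero_ne_zero (k := k) (by rw [← hu', hu0', map_zero])

theorem not_isNKoszul {N : ℕ} (hN : 2 ≤ N) : ¬ IsNKoszul (component k) (augmentation k) N := by
  rintro ⟨ι, d, p, hp, hdp, hd, hdeg⟩
  have hdeg0 (i : ι 1) (j : ι 0) : d 0 (Finsupp.single i 1) j ∈ component k 1 := by
    obtain ⟨a, ha, h⟩ := hdeg 0 i j
    obtain rfl : a = 1 := by simpa [koszulJump] using ha
    exact h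
  have hdeg1 (i : ι 2) (j : ι 1) : d 1 (Finsupp.single i 1) j ∈ component k (N - 1) := by
    obtain ⟨a, ha, h⟩ := hdeg 1 i j
    -- The jump from P₁ to P₂ is from degree 1 to degree N.
    obtain rfl : a = N - 1 := by
      simp [koszulJump] at ha
      omega
    exact h
  obtain ⟨i, hi⟩ : ∃ i, p (Finsupp.single i 1) ≠ 0 := by
    by_contra! h
    obtain ⟨v, hv⟩ := hp (1 : k)
    have : p = 0 := by
      ext i
      simpa using h i
    rw [this] at hv
    exact zero_ne_one (α := k) hv
  obtain ⟨c, hc⟩ : ∃ c : k, p (Finsupp.single i 1) = c := ⟨_, rfl⟩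
  have hc0 : c ≠ 0 := fun h => hi (hc.trans h)
  have hp_single (j : ι 0) (a : A) (b : k) (hb : p (Finsupp.single j 1) = b) :
      p (Finsupp.single j a) = (augmentation k a * b : k) := by
    have : Finsupp.single j a = a • Finsupp.single j (1 : A) := by simp
    rw [this, map_smul, hb]
    rfl
  -- P₀ has rank one: a second generator would give an element of ker p with a nonzero constant
  -- coordinate, while the image of d 0 has no constant part.
  have hsub (j : ι 0) : j = i := by
    by_contra hij
    obtain ⟨b, hb⟩ : ∃ b : k, p (Finsupp.single j 1) = b := ⟨_, rfl⟩
    obtain ⟨v, hv⟩ := (hdp (Finsupp.single j (algebraMap k A c) -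
      Finsupp.single i (algebraMap k A b))).1 (by
        rw [map_sub, sub_eq_zero, hp_single j _ _ hb, hp_single i _ _ hc, AlgHom.commutes,
          AlgHom.commutes]
        exact mul_comm c b)
    have h := proj_map_of_lt ((Finsupp.lapply j).comp (d 0)) (fun l => hdeg0 l j) zero_lt_one v
    rw [LinearMap.comp_apply, hv, Finsupp.lapply_apply, Finsupp.sub_apply, Finsupp.single_eq_same,
      Finsupp.single_eq_of_ne hij, sub_zero, GradedRing.proj_apply,
      DirectSum.decompose_of_mem_same _ (SetLike.algebraMap_mem_graded _ c)] at h
    apply hc0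
    simpa using congrArg (augmentation k) h
  have hsurj (l : Fin 2) : ∃ u, ((Finsupp.lapply i).comp (d 0)) u = gen k l := by
    obtain ⟨u, hu⟩ := (hdp (Finsupp.single i (gen k l))).1 (by
      rw [hp_single i _ _ hc, augmentation_gen, zero_mul]
      rfl)
    exact ⟨u, by simp [hu]⟩
  refine not_exact_of_homogeneous ((Finsupp.lapply i).comp (d 0)) (d 1) (n := N - 1) (by omega)
    (fun l => hdeg0 l i) hdeg1 (hsurj 0) (hsurj 1) fun v => ?_
  rw [← hd 0 v]
  constructor
  · intro h
    ext j
    rw [hsub j]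
    exact h
  · intro h
    simp [h]

end SuperJordanPlane

theorem mainTheorem3 {k : Type u} [Field k] [CharZero k] :
    IsK2 (SuperJordanPlane.augmentation k) ∧
      ∀ N : ℕ, 2 ≤ N →
        ¬ IsNKoszul (SuperJordanPlane.component k) (SuperJordanPlane.augmentation k) N :=
  ⟨SuperJordanPlane.isK2 k, fun _ hN => SuperJordanPlane.not_isNKoszul hN⟩
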